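/- Let $R$ be a commutative Noetherian ring and $(A,\{\Delta(\lambda)\}_{\lambda\in\Lambda})$ a split quasi-hereditary $R$-algebra. That is: $A$ is an $R$-algebra that is finitely generated projective as an $R$-module, $\Lambda$ is a poset, the $\Delta(\lambda)$ are finitely generated left $A$-modules that are projective over $R$, and - $\operatorname{Hom}_A(\Delta(\lambda),\Delta(\mu))\neq 0$ implies $\lambda\le\mu$; - $\operatorname{End}_A(\Delta(\lambda))\simeq R$ for all $\lambda\in\Lambda$; - for each $\lambda$ there are a finitely generated projective $A$-module $P(\lambda)$ and a surjection $P(\lambda)\to\Delta(\lambda)$ whose kernel has a finite filtration with factors of the form $\Delta(\mu)\otimes_R U$, with $\mu>\lambda$ and $U$ a finitely generated projective $R$-module, and $\bigoplus_{\lambda}P(\lambda)$ is a progenerator. Let $\mathcal F(\tilde\Delta)$ be the class of $A$-modules with a finite filtration whose factors are of the form $\Delta(\lambda)\otimes_R U$, with $\lambda\in\Lambda$ and $U$ a finitely generated projective $R$-module. For a ring $C$, a finitely generated projective left $C$-module $Q$, a class $\mathcal A$ of $C$-modules and an integer $i\ge 0$, the pair $(C,Q)$ is called an $i$-$\mathcal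 A$ cover of $D=\operatorname{End}_C(Q)^{op}$ if the exact functor $F_Q=\operatorname{Hom}_C(Q,-)\colon C\text{-Mod}\to D\text{-Mod}$ induces isomorphisms $$\operatorname{Ext}^j_C(M,N)\to\operatorname{Ext}^j_D(F_QM,F_QN)\qquad\text{for all } M,N\in\mathcal A,\ 0\le j\le i .$$ Let $J$ be a split heredity ideal of $A$: a two-sided ideal such that $A/J$ is finitely generated projective over $R$, $J$ is finitely generated projective as a left $A$-module, $J^2=J$, and the $R$-algebra $\operatorname{End}_A(J)^{op}$ is Morita equivalent to $R$. Let $\mathcal F(\tilde\Delta_{A/J})=\mathcal F(\tilde\Delta)\cap A/J\text{-mod}$ be the class of $A/J$-modules which, regarded as $A$-modules, lie in $\mathcal F(\tilde\Delta)$. Theorem. Let $i\ge 0$ be an integer. If $(A,P)$ is an $i$-$\mathcal F(\tilde\Delta)$ cover of $\operatorname{End}_A(P)^{op}$, then $(A/J,P/JP)$ is an $i$-$\mathcal F(\tilde\Delta_{A/J})$ cover of $\operatorname{End}_{A/J}(P/JP)^{op}$. Moreover, whenever $\lambda_0\in\Lambda$ is maximal and $J$ is the trace $\sum_{f\in\operatorname{Hom}_A(\Delta(\lambda_0),A)}\operatorname{im}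 f$ of $\Delta(\lambda_0)$ in $A$, the class $\mathcal F(\tilde\Delta_{A/J})$ consists exactly of the $A/J$-modules with a finite filtration whose factors are $A/J$-modules that are isomorphic, as $A$-modules, to some $\Delta(\mu)\otimes_R U$ with $\mu\neq\lambda_0$ and $U$ a finitely generated projective $R$-module. -/

import Mathlib

open CategoryTheory
open scoped TensorProduct DirectSum

universe u v

namespace SplitQH

section Modules

variable {A : Type u} [Ring A]

/-- `HasFiltration S X`: the `A`-module `X` admits a finite filtration
`0 = X₀ ⊆ X₁ ⊆ ⋯ ⊆ Xₙ = X` all of whose factors `Xₖ / Xₖ₋₁` satisfy `S`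
(built up one top factor at a time). -/
inductive HasFiltration (S : ModuleCat.{u} A → Prop) : ModuleCat.{u} A → Prop
  | zero (X : ModuleCat.{u} A) (h : Subsingleton X) : HasFiltration S X
  | step (X' X Q : ModuleCat.{u} A) (f : X' →ₗ[A] X) (g : X →ₗ[A] Q)
      (hf : Function.Injective f) (hfg : Function.Exact f g) (hg : Function.Surjective g)
      (hX' : HasFiltration S X') (hQ : S Q) : HasFiltration S X

/-- `M` is a generator: `A` is a direct summand of a finite direct sum of copies of `M`. -/
def IsGenerator (A : Type u) [Ring A] (M : Type v) [AddCommGroup M] [Module A M] : Prop :=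
  ∃ (n : ℕ) (s : A →ₗ[A] (Fin n → M)) (p : (Fin n → M) →ₗ[A] A), p ∘ₗ s = LinearMap.id

/-- `M` is a progenerator: a finitely generated projective generator. -/
def IsProgenerator (A : Type u) [Ring A] (M : Type v) [AddCommGroup M] [Module A M] : Prop :=
  Module.Finite A M ∧ Module.Projective A M ∧ IsGenerator A M

/-- The Schur functor `F_P = Hom_A(P, -)` from `A`-modules to left modules over `End_A(P)ᵒᵖ`. -/
noncomputable abbrev schurFunctor (A : Type u) [Ring A] (P : Type u) [AddCommGroup P]
    [Module A P] :
    ModuleCat.{u} A ⥤ ModuleCat.{u} (End (ModuleCat.of A P))ᵐᵒᵖ :=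
  preadditiveCoyonedaObj (ModuleCat.of A P)

/-- Let `𝒜` be a class of `A`-modules. `(A, P)` is an `i-𝒜` cover of `End_A(P)ᵒᵖ`: the module `P`
is finitely generated projective (so that `F_P` is exact), and the maps
`Ext^j_A(M, N) → Ext^j_{End_A(P)ᵒᵖ}(F_P M, F_P N)` induced by `F_P` are bijective for all
`M, N` in `𝒜` and all `0 ≤ j ≤ i`. -/
def IsCover (i : ℕ) (𝒜 : ModuleCat.{u} A → Prop) (P : Type u) [AddCommGroup P]
    [Module A P] : Prop :=
  Module.Finite A P ∧ ∃ _ : Projective (ModuleCat.of A P),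
    ∀ M N : ModuleCat.{u} A, 𝒜 M → 𝒜 N → ∀ j : ℕ, j ≤ i →
      Function.Bijective
        ((schurFunctor A P).mapExtAddHom M N j :
          Abelian.Ext M N j → Abelian.Ext ((schurFunctor A P).obj M) ((schurFunctor A P).obj N) j)

end Modules

section Algebras

variable (R : Type u) [CommRing R] {A : Type u} [Ring A] [Algebra R A]
  {Λ : Type v} (Δ : Λ → Type u) [∀ l, AddCommGroup (Δ l)] [∀ l, Module R (Δ l)]
  [∀ l, Module A (Δ l)] [∀ l, IsScalarTower R A (Δ l)]

/-- The `A`-module `X` is isomorphic to `Δ(l) ⊗_R U` for some `l` with `p l` and some finitely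
generated projective `R`-module `U`. -/
def IsStandardTensor (p : Λ → Prop) (X : ModuleCat.{u} A) : Prop :=
  ∃ l : Λ, p l ∧ ∃ (U : Type u) (_ : AddCommGroup U) (_ : Module R U),
    Module.Finite R U ∧ Module.Projective R U ∧ Nonempty (X ≃ₗ[A] Δ l ⊗[R] U)

/-- The class `𝓕(Δ̃)` of `A`-modules. -/
def FDelta (X : ModuleCat.{u} A) : Prop :=
  HasFiltration (IsStandardTensor R Δ fun _ => True) X

/-- `(A, {Δ(l)})` is a split quasi-hereditary `R`-algebra. -/
structure IsSplitQuasiHereditary (R : Type u) [CommRing R] (A : Type u) [Ring A] [Algebra R A]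
    {Λ : Type v} [PartialOrder Λ] (Δ : Λ → Type u) [∀ l, AddCommGroup (Δ l)]
    [∀ l, Module R (Δ l)] [∀ l, Module A (Δ l)] [∀ l, IsScalarTower R A (Δ l)] : Prop where
  finite_algebra : Module.Finite R A
  projective_algebra : Module.Projective R A
  finite_standard : ∀ l, Module.Finite A (Δ l)
  projective_standard : ∀ l, Module.Projective R (Δ l)
  le_of_hom_ne_zero : ∀ l m, (∃ f : Δ l →ₗ[A] Δ m, f ≠ 0) → l ≤ m
  end_standard : ∀ l, Nonempty (Module.End A (Δ l) ≃ₐ[R] R)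
  exists_progenerator : ∃ P : Λ → ModuleCat.{u} A,
    (∀ l, Module.Finite A (P l) ∧ Module.Projective A (P l) ∧
      ∃ π : P l →ₗ[A] Δ l, Function.Surjective π ∧
        HasFiltration (IsStandardTensor R Δ fun m => l < m)
          (ModuleCat.of A (LinearMap.ker π))) ∧
    IsProgenerator A (⨁ l, P l)

/-- A two-sided ideal `J` of the `R`-algebra `A` is split heredity. -/
structure IsSplitHeredityIdeal (J : Ideal A) [J.IsTwoSided] : Prop where
  finite_quotient : Module.Finite R (A ⧸ J)
  projective_quotient : Module.Projective R (A ⧸ J)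
  finite_ideal : Module.Finite A J
  projective_ideal : Module.Projective A J
  mul_self : J * J = J
  morita : IsMoritaEquivalent R (Module.End A J)ᵐᵒᵖ R

/-- The inflation functor from `A/J`-modules to `A`-modules. -/
noncomputable abbrev inflation (J : Ideal A) [J.IsTwoSided] :
    ModuleCat.{u} (A ⧸ J) ⥤ ModuleCat.{u} A :=
  ModuleCat.restrictScalars (Ideal.Quotient.mk J)

/-- The class of `A/J`-modules `𝓕(Δ̃_{A/J}) = 𝓕(Δ̃) ∩ A/J-mod`. -/
def FDeltaQuotient (J : Ideal A) [J.IsTwoSided] (X : ModuleCat.{u} (A ⧸ J)) : Prop :=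
  FDelta R Δ ((inflation J).obj X)

end Algebras

end SplitQH

/-! Write `B = A/J`, `P' = P/JP`, `D = End_A(P)ᵒᵖ`, `D' = End_B(P')ᵒᵖ`, and let `N` be a `B`-module
in the class. The projection `P → P'` is universal among maps from `P` to `B`-modules. It therefore
induces a ring map `D → D'`, surjective because `P` is projective, and identifies `Hom_A(P, -)` on
`B`-modules with the restriction of `Hom_B(P', -)` along `D → D'`. In the resulting square on `Ext`,
the map for `F_{P'}` is bijective once the other three are (`mapExtAddHom_bijective_of_square`). The
map for `F_P` is bijective by hypothesis.

Inflation: `J = J²` and `JN = 0` force `Hom_A(J, N) = 0`, and `J` is projective, so `Ext_A(J, N) =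
0` in all degrees. The sequence `0 → J → A → B → 0` then gives `Ext_A^k(B, N) = 0` for `k > 0`,
which suffices by `mapExtAddHom_bijective_of_vanishing`.

Restriction along `D → D'`: the same criterion asks that `Ext_D^k(D', F_P N) = 0` for `1 ≤ k ≤ i`.
Applying `F_P` to `0 → JP → P → P' → 0` presents `D'` as `D / F_P(JP)`, so it is enough that
`Ext_D^{k-1}(F_P(JP), F_P N) = 0`. Now `JP` is a summand of some `Jⁿ`, `J` of some `Aᵐ`, and `A` of
a finite sum of modules `P(λ)`, which lie in `𝓕(Δ̃)`. Hence the cover hypothesis identifies this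
group with `Ext_A^{k-1}(JP, N)`, which vanishes because `Ext_A(J, N)` does.

For the description of the class, `Δ(λ₀)` is projective when `λ₀` is maximal, so its trace ideal `J`
satisfies `J Δ(λ₀) = Δ(λ₀)`. All factors of a filtration of a `B`-module are killed by `J`, so
factors `Δ(λ₀) ⊗ U` are zero and can be dropped. -/

namespace SplitQH

/-! ### Maps induced on `Ext` by exact functors, and vanishing criteria -/

section ExtMaps

open Limits Abelian

universe w₁ w₂ w₃ w₄ v₁ v₂ v₃ v₄ u₁ u₂ u₃ u₄

variable {C : Type u₁} [Category.{v₁} C] [Abelian C] [HasExt.{w₁} C]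
  {D : Type u₂} [Category.{v₂} D] [Abelian D] [HasExt.{w₂} D]

lemma mapExactFunctor_mapExactFunctor_extClass {E : Type u₄} [Category.{v₄} E] [Abelian E]
    [HasExt.{w₄} E] {S : ShortComplex C} (hS : S.ShortExact)
    (F : C ⥤ D) [F.Additive] [PreservesFiniteLimits F] [PreservesFiniteColimits F]
    (G : D ⥤ E) [G.Additive] [PreservesFiniteLimits G] [PreservesFiniteColimits G] :
    (hS.extClass.mapExactFunctor F).mapExactFunctor G =
      ((hS.map_of_exact F).map_of_exact G).extClass := by
  rw [Ext.mapExactFunctor_extClass]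
  exact Ext.mapExactFunctor_extClass G (hS.map_of_exact F)

/-- The maps induced on `Ext` by the two composites of a square of exact functors that commutes up
to isomorphism agree. -/
lemma mapExactFunctor_natIso
    {D' : Type u₃} [Category.{v₃} D'] [Abelian D'] [HasExt.{w₃} D']
    {E : Type u₄} [Category.{v₄} E] [Abelian E] [HasExt.{w₄} E] [EnoughProjectives C]
    (F : C ⥤ D) [F.Additive] [PreservesFiniteLimits F] [PreservesFiniteColimits F]
    (G : D ⥤ E) [G.Additive] [PreservesFiniteLimits G] [PreservesFiniteColimits G]
    (F' : C ⥤ D') [F'.Additive] [PreservesFiniteLimits F'] [PreservesFiniteColimits F']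
    (G' : D' ⥤ E) [G'.Additive] [PreservesFiniteLimits G'] [PreservesFiniteColimits G']
    (θ : F ⋙ G ≅ F' ⋙ G') {X Y : C} {n : ℕ} (e : Ext X Y n) :
    ((e.mapExactFunctor F).mapExactFunctor G).comp (Ext.mk₀ (θ.hom.app Y)) (add_zero n) =
      (Ext.mk₀ (θ.hom.app X)).comp ((e.mapExactFunctor F').mapExactFunctor G') (zero_add n) := by
  induction n generalizing X with
  | zero =>
    obtain ⟨f, rfl⟩ := (Ext.mk₀_bijective X Y).2 e
    simp only [Ext.mapExactFunctor_mk₀, Ext.mk₀_comp_mk₀]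
    exact congrArg Ext.mk₀ (θ.hom.naturality f)
  | succ n hn =>
    let Q : ProjectivePresentation X := Classical.arbitrary _
    have := Q.projective
    let S := ShortComplex.mk _ _ (kernel.condition Q.f)
    have hS : S.ShortExact := { exact := ShortComplex.exact_kernel Q.f }
    -- Dimension shift: every class of degree `n + 1` is the extension class of `S` times a class of
    -- degree `n`.
    obtain ⟨x, rfl⟩ := Ext.contravariant_sequence_exact₃ hS Y e
      (Ext.eq_zero_of_projective (P := Q.p) _) (add_comm 1 n)
    -- The components of `θ` form a morphism between the two images of `S`, so their extension
    -- classes correspond.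
    have key : ((hS.extClass.mapExactFunctor F).mapExactFunctor G).comp
        (Ext.mk₀ (θ.hom.app S.X₁)) (add_zero 1) =
        (Ext.mk₀ (θ.hom.app S.X₃)).comp ((hS.extClass.mapExactFunctor F').mapExactFunctor G')
          (zero_add 1) := by
      rw [mapExactFunctor_mapExactFunctor_extClass, mapExactFunctor_mapExactFunctor_extClass]
      exact ShortComplex.ShortExact.extClass_naturality ((hS.map_of_exact F).map_of_exact G)
        ((hS.map_of_exact F').map_of_exact G')
        { τ₁ := θ.hom.app _, τ₂ := θ.hom.app _, τ₃ := θ.hom.app _,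
          comm₁₂ := (θ.hom.naturality S.f).symm, comm₂₃ := (θ.hom.naturality S.g).symm }
    simp only [Ext.mapExactFunctor_comp]
    rw [Ext.comp_assoc_of_third_deg_zero, hn x, ← Ext.comp_assoc_of_second_deg_zero]
    refine (congrArg (fun z => Ext.comp z _ (add_comm 1 n)) key).trans ?_
    exact Ext.comp_assoc _ _ _ (zero_add 1) (add_comm 1 n) (by lia)

/-- A fully faithful exact functor `G` induces bijections `Ext^j(X, Y) → Ext^j(GX, GY)` for `j ≤ i`
if `Ext^k(GQ, GY)` vanishes for `Q` projective and `1 ≤ k ≤ i`. -/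
lemma mapExtAddHom_bijective_of_vanishing (G : C ⥤ D) [G.Additive] [PreservesFiniteLimits G]
    [PreservesFiniteColimits G] [G.Full] [G.Faithful] [EnoughProjectives C] (Y : C) (i : ℕ)
    (h : ∀ Q : C, Projective Q → ∀ k, k < i → Subsingleton (Ext (G.obj Q) (G.obj Y) (k + 1)))
    (X : C) (j : ℕ) (hj : j ≤ i) : Function.Bijective (G.mapExtAddHom X Y j) := by
  induction j generalizing X with
  | zero =>
    simpa [Ext.mapExactFunctor₀] using ⟨Functor.Faithful.map_injective, Functor.Full.map_surjective⟩
  | succ n hn =>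
    let Q : ProjectivePresentation X := Classical.arbitrary _
    have := Q.projective
    let S := ShortComplex.mk _ _ (kernel.condition Q.f)
    have hS : S.ShortExact := { exact := ShortComplex.exact_kernel Q.f }
    -- Five lemma for the long exact sequences of `S` and of its image under `G`. The terms of
    -- degree `n + 1` at the projective cover `Q.p` and at its image vanish, by projectivity and by
    -- `h` respectively.
    exact AddMonoidHom.bijective_of_surjective_of_bijective_of_right_exact _ _ _ _
      (G.mapExtAddHom S.X₂ Y n) (G.mapExtAddHom S.X₁ Y n) (G.mapExtAddHom S.X₃ Y (n + 1))
      (by ext; simp [Ext.mapExactFunctor_comp, Ext.mapExactFunctor_mk₀]; rfl)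
      (by ext; simp [Ext.mapExactFunctor_comp, Ext.mapExactFunctor_extClass]; rfl)
      ((ShortComplex.ab_exact_iff_function_exact _).1
        (Ext.contravariant_sequence_exact₁' hS Y n (n + 1) (add_comm 1 n)))
      ((ShortComplex.ab_exact_iff_function_exact _).1
        (Ext.contravariant_sequence_exact₁' (hS.map G) (G.obj Y) n (n + 1) (add_comm 1 n)))
      (hn _ (by lia)).surjective (hn _ (by lia))
      (fun x₃ ↦ Ext.contravariant_sequence_exact₃ hS _ x₃
        (Ext.eq_zero_of_projective (P := Q.p) _) (add_comm 1 n))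
      (fun y₃ ↦ Ext.contravariant_sequence_exact₃ (hS.map G) _ y₃
        ((h Q.p Q.projective n (by lia)).elim _ _) (add_comm 1 n))

/-- Vanishing of `Ext` in positive degrees passes to coproducts in the first argument. -/
lemma subsingleton_ext_of_isColimit_cofan [EnoughInjectives C] {S : Type*} {X : S → C}
    (c : Cofan X) (hc : IsColimit c) (k : ℕ) (Y : C)
    (h : ∀ s, Subsingleton (Ext (X s) Y (k + 1))) : Subsingleton (Ext c.pt Y (k + 1)) := by
  induction k generalizing Y with
  | zero =>
    refine subsingleton_of_forall_eq 0 fun e => ?_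
    let I : InjectivePresentation Y := Classical.arbitrary _
    have := I.injective
    let T := ShortComplex.mk _ _ (cokernel.condition I.f)
    have hT : T.ShortExact := { exact := ShortComplex.exact_cokernel I.f }
    obtain ⟨x, rfl⟩ := Ext.covariant_sequence_exact₁ _ hT e
      (Ext.eq_zero_of_injective (I := I.J) _) rfl
    obtain ⟨f, rfl⟩ := (Ext.mk₀_bijective _ _).2 x
    -- A class of degree one is the obstruction to lifting some `f` along `T.g`. It vanishes on each
    -- summand, and the lifts on the summands glue by the universal property of the coproduct.
    have hl (s : S) : ∃ g : X s ⟶ T.X₂, g ≫ T.g = c.inj s ≫ f := by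
      obtain ⟨y, hy⟩ := Ext.covariant_sequence_exact₃ _ hT (Ext.mk₀ (c.inj s ≫ f)) rfl
        ((h s).elim _ _)
      obtain ⟨g, rfl⟩ := (Ext.mk₀_bijective _ _).2 y
      exact ⟨g, (Ext.mk₀_bijective _ _).1 (by simpa using hy)⟩
    choose g hg using hl
    have hf : Cofan.IsColimit.desc hc g ≫ T.g = f :=
      Cofan.IsColimit.hom_ext hc _ _ fun s => by simp [hg]
    rw [← hf, ← Ext.mk₀_comp_mk₀, Ext.comp_assoc _ _ _ (zero_add 0) (zero_add 1) (by lia),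
      hT.comp_extClass, Ext.comp_zero]
  | succ k hk =>
    refine subsingleton_of_forall_eq 0 fun e => ?_
    let I : InjectivePresentation Y := Classical.arbitrary _
    have := I.injective
    let T := ShortComplex.mk _ _ (cokernel.condition I.f)
    have hT : T.ShortExact := { exact := ShortComplex.exact_cokernel I.f }
    obtain ⟨x, rfl⟩ := Ext.covariant_sequence_exact₁ _ hT e
      (Ext.eq_zero_of_injective (I := I.J) _) rfl
    -- Dimension shift in the second argument, replacing `Y` by its cosyzygy `T.X₃`.
    have : Subsingleton (Ext c.pt T.X₃ (k + 1)) := hk T.X₃ fun s =>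
      subsingleton_of_forall_eq 0 fun y => by
        obtain ⟨z, rfl⟩ := Ext.covariant_sequence_exact₃ _ hT y (n₁ := k + 1 + 1) rfl
          ((h s).elim _ _)
        rw [Ext.eq_zero_of_injective (I := I.J) z, Ext.zero_comp]
    rw [Subsingleton.elim x 0, Ext.zero_comp]

/-- Vanishing of `Ext` passes to retracts in the first argument. -/
lemma subsingleton_ext_of_retract {X Z Y : C} (s : X ⟶ Z) (p : Z ⟶ X) (hsp : s ≫ p = 𝟙 X) (k : ℕ)
    (h : Subsingleton (Ext Z Y k)) : Subsingleton (Ext X Y k) := by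
  refine subsingleton_of_forall_eq 0 fun e => ?_
  rw [← Ext.mk₀_id_comp e, ← hsp, ← Ext.mk₀_comp_mk₀,
    Ext.comp_assoc _ _ _ (zero_add 0) (zero_add k) (by lia),
    Subsingleton.elim ((Ext.mk₀ p).comp e (zero_add k)) 0, Ext.comp_zero]

/-- If `G` preserves coproducts and `W` is a separator, then vanishing of `Ext^k(GW, Y)` for a
positive `k` implies vanishing of `Ext^k(GQ, Y)` for all projective `Q`. -/
lemma subsingleton_ext_of_isSeparator {C : Type u₁} [Category.{v₁} C] [HasCoproducts.{v₁} C]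
    [EnoughInjectives D] (G : C ⥤ D)
    [PreservesColimitsOfSize.{v₁, v₁} G] {W : C} (hW : IsSeparator W) (k : ℕ) (Y : D)
    (h : Subsingleton (Ext (G.obj W) Y (k + 1))) (Q : C) [Projective Q] :
    Subsingleton (Ext (G.obj Q) Y (k + 1)) := by
  have := (isSeparator_iff_epi W).1 hW Q
  -- Since `W` is a separator, `π` is epi; it splits because `Q` is projective, so `Q` is a retract
  -- of a coproduct of copies of `W`.
  let π : (∐ fun _ : W ⟶ Q => W) ⟶ Q := Sigma.desc fun f => f
  refine subsingleton_ext_of_retract (G.map (Projective.factorThru (𝟙 Q) π)) (G.map π)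
    (by rw [← G.map_comp, Projective.factorThru_comp, G.map_id]) _ ?_
  exact subsingleton_ext_of_isColimit_cofan
    (Cofan.mk (G.obj (∐ fun _ : W ⟶ Q => W)) fun f => G.map (Sigma.ι (fun _ : W ⟶ Q => W) f))
    (isColimitCofanMkObjOfIsColimit G _ _ (coproductIsCoproduct fun _ : W ⟶ Q => W)) k Y
    fun _ => h

/-- Dimension shift: vanishing of `Ext^k` at the first term of a short exact sequence with
`Ext`-acyclic middle term gives vanishing of `Ext^{k+1}` at the last one. -/
lemma subsingleton_ext_of_shortExact {S : ShortComplex C} (hS : S.ShortExact) (Y : C) (k : ℕ)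
    (h₁ : Subsingleton (Ext S.X₁ Y k)) (h₂ : Subsingleton (Ext S.X₂ Y (k + 1))) :
    Subsingleton (Ext S.X₃ Y (k + 1)) := by
  refine subsingleton_of_forall_eq 0 fun e => ?_
  obtain ⟨x, rfl⟩ := Ext.contravariant_sequence_exact₃ hS Y e (h₂.elim _ _) (add_comm 1 k)
  rw [h₁.elim x 0, Ext.comp_zero]

/-- If the identity of `X` is a finite sum of maps factoring through objects `Z t` for which
`Ext^j(Z t, Y) → Ext^j(F (Z t), F Y)` is bijective, then the map for `X` is bijective. -/
lemma mapExtAddHom_bijective_of_sum (F : C ⥤ D) [F.Additive] [PreservesFiniteLimits F]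
    [PreservesFiniteColimits F] {X Y : C} {T : Type*} [Fintype T] (Z : T → C) (s : ∀ t, X ⟶ Z t)
    (p : ∀ t, Z t ⟶ X) (hsp : ∑ t, s t ≫ p t = 𝟙 X) (j : ℕ)
    (h : ∀ t, Function.Bijective (F.mapExtAddHom (Z t) Y j)) :
    Function.Bijective (F.mapExtAddHom X Y j) := by
  constructor
  · rw [injective_iff_map_eq_zero]
    intro e he
    have h0 (t : T) : (Ext.mk₀ (p t)).comp e (zero_add j) = 0 := by
      apply (h t).1
      rw [map_zero, Functor.mapExtAddHom_apply, Ext.mapExactFunctor_comp,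
        ← Functor.mapExtAddHom_apply F X Y j, he, Ext.comp_zero]
    rw [← Ext.mk₀_id_comp e, ← hsp, Ext.mk₀_sum, Ext.sum_comp]
    refine Finset.sum_eq_zero fun t _ => ?_
    rw [← Ext.mk₀_comp_mk₀, Ext.comp_assoc _ _ _ (zero_add 0) (zero_add j) (by lia), h0,
      Ext.comp_zero]
  · intro e
    choose a ha using fun t => (h t).2 ((Ext.mk₀ (F.map (p t))).comp e (zero_add j))
    refine ⟨∑ t, (Ext.mk₀ (s t)).comp (a t) (zero_add j), ?_⟩
    have (t : T) : F.mapExtAddHom X Y j ((Ext.mk₀ (s t)).comp (a t) (zero_add j)) =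
        (Ext.mk₀ (F.map (s t ≫ p t))).comp e (zero_add j) := by
      rw [Functor.mapExtAddHom_apply, Ext.mapExactFunctor_comp,
        ← Functor.mapExtAddHom_apply F (Z t) Y j, ha,
        Ext.mapExactFunctor_mk₀, F.map_comp, ← Ext.mk₀_comp_mk₀,
        Ext.comp_assoc _ _ _ (zero_add 0) (zero_add j) (by lia)]
    rw [map_sum, Finset.sum_congr rfl fun t _ => this t, ← Ext.sum_comp, ← Ext.mk₀_sum,
      ← F.map_sum, hsp, F.map_id, Ext.mk₀_id_comp]

end ExtMaps

/-! ### Restriction of scalars: exactness, coproducts, fullness -/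

section RestrictScalars

open Limits

variable {R S : Type u} [Ring R] [Ring S] (f : R →+* S)

lemma restrictScalars_map_exact (T : ShortComplex (ModuleCat.{u} S)) (h : T.Exact) :
    (T.map (ModuleCat.restrictScalars.{u} f)).Exact := by
  rw [ShortComplex.ShortExact.moduleCat_exact_iff_function_exact] at h ⊢
  exact h

instance preservesFiniteLimits_restrictScalars :
    PreservesFiniteLimits (ModuleCat.restrictScalars.{u} f) := by
  have := ((Functor.exact_tfae (ModuleCat.restrictScalars.{u} f)).out 1 3).mp
    (restrictScalars_map_exact f)
  exact this.1

instance preservesFiniteColimits_restrictScalars :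
    PreservesFiniteColimits (ModuleCat.restrictScalars.{u} f) := by
  have := ((Functor.exact_tfae (ModuleCat.restrictScalars.{u} f)).out 1 3).mp
    (restrictScalars_map_exact f)
  exact this.2

instance preservesColimitsOfSize_restrictScalars :
    PreservesColimitsOfSize.{u, u} (ModuleCat.restrictScalars.{u} f) :=
  (ModuleCat.restrictCoextendScalarsAdj.{u} f).leftAdjoint_preservesColimits

lemma full_restrictScalars (hf : Function.Surjective f) :
    (ModuleCat.restrictScalars.{u} f).Full where
  map_surjective {X Y} g := by
    refine ⟨ModuleCat.ofHom (X := X) (Y := Y)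
      { toFun := fun x => g x
        map_add' := fun x y => map_add g.hom x y
        map_smul' := fun s x => ?_ }, rfl⟩
    obtain ⟨r, rfl⟩ := hf s
    exact g.hom.map_smul r x

end RestrictScalars

/-! ### Endomorphism rings and Hom functors along a universal map -/

section UniversalMap

open Limits Abelian

universe v₁ u₁ u₂

variable {C : Type u₁} [Category.{v₁} C] [Abelian C] {D : Type u₂} [Category.{v₁} D] [Abelian D]
  (I : C ⥤ D) [I.Additive] {P : D} {P' : C} (q : P ⟶ I.obj P')
  (hq : ∀ N : C, Function.Bijective fun g : P' ⟶ N => q ≫ I.map g)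

include hq

/-- The ring map `End P → End P'` induced by a universal map `q : P ⟶ I P'`. -/
noncomputable def endHom : End P →+* End P' where
  toFun f := (Equiv.ofBijective _ (hq P')).symm (End.asHom f ≫ q)
  map_one' := by
    rw [Equiv.symm_apply_eq]
    simp [End.one_def]
  map_mul' f g := by
    rw [Equiv.symm_apply_eq]
    have hs (f : P ⟶ P) : q ≫ I.map ((Equiv.ofBijective _ (hq P')).symm (f ≫ q)) = f ≫ q :=
      (Equiv.ofBijective _ (hq P')).apply_symm_apply (f ≫ q)
    simp only [End.mul_def, Equiv.ofBijective_apply, I.map_comp]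
    rw [reassoc_of% (hs g), hs f, ← Category.assoc]
  map_zero' := by
    rw [Equiv.symm_apply_eq]
    simp
  map_add' f g := by
    rw [Equiv.symm_apply_eq]
    have hs (f : P ⟶ P) : q ≫ I.map ((Equiv.ofBijective _ (hq P')).symm (f ≫ q)) = f ≫ q :=
      (Equiv.ofBijective _ (hq P')).apply_symm_apply (f ≫ q)
    simp only [Equiv.ofBijective_apply, I.map_add, Preadditive.comp_add]
    rw [hs f, hs g, ← Preadditive.add_comp]

lemma endHom_spec (f : End P) : q ≫ I.map (endHom I q hq f) = End.asHom f ≫ q :=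
  (Equiv.ofBijective _ (hq P')).apply_symm_apply (End.asHom f ≫ q)

/-- Projectivity of `P` lifts `q ≫ I.map g` through the epimorphism `q`, and universality makes the
lift a preimage of `g`. -/
lemma endHom_surjective [Projective P] [Epi q] : Function.Surjective (endHom I q hq) := by
  intro g
  refine ⟨Projective.factorThru (q ≫ I.map g) q, (hq P').1 ?_⟩
  exact (endHom_spec I q hq _).trans (Projective.factorThru_comp _ _)

/-- Precomposition with a universal map `q : P ⟶ I P'`, as a linear map. -/
noncomputable def universalPrecomp (N : C) :
    (ModuleCat.restrictScalars (RingHom.op (endHom I q hq))).obj ((preadditiveCoyonedaObj P').obj N)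
      →ₗ[(End P)ᵐᵒᵖ] (preadditiveCoyonedaObj P).obj (I.obj N) where
  toFun g := q ≫ I.map (show P' ⟶ N from g)
  map_add' g h := by
    change q ≫ I.map ((show P' ⟶ N from g) + (show P' ⟶ N from h)) = _
    rw [I.map_add, Preadditive.comp_add]
    rfl
  map_smul' b g := by
    have h := endHom_spec I q hq b.unop
    change q ≫ I.map (endHom I q hq b.unop ≫ (show P' ⟶ N from g)) =
      End.asHom b.unop ≫ q ≫ I.map (show P' ⟶ N from g)
    rw [I.map_comp, reassoc_of% h]

/-- For a universal map `q : P ⟶ I P'`, the functors `Hom(P, I -)` and `Hom(P', -)` agree. -/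
noncomputable def compCoyonedaIso :
    I ⋙ preadditiveCoyonedaObj P ≅
      preadditiveCoyonedaObj P' ⋙ ModuleCat.restrictScalars (RingHom.op (endHom I q hq)) :=
  Iso.symm <| NatIso.ofComponents (fun N => LinearEquiv.toModuleIso
    (X₁ := (ModuleCat.restrictScalars (RingHom.op (endHom I q hq))).obj
      ((preadditiveCoyonedaObj P').obj N))
    (X₂ := (preadditiveCoyonedaObj P).obj (I.obj N))
    (LinearEquiv.ofBijective (universalPrecomp I q hq N) (hq N))) fun {M N} f => by
    ext (g : P' ⟶ M)
    have : q ≫ I.map (g ≫ f) = (q ≫ I.map g) ≫ I.map f := by rw [I.map_comp, Category.assoc]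
    exact this

end UniversalMap

/-! ### The regular module over the opposite endomorphism ring -/

section Coyoneda

universe v₁ u₁

variable {C : Type u₁} [Category.{v₁} C] [Abelian C]

/-- This is the regular module over `(End P)ᵐᵒᵖ`: the identity can be sent to any element of any
module. -/
lemma isSeparator_preadditiveCoyonedaObj_self (P : C) :
    IsSeparator ((preadditiveCoyonedaObj P).obj P) := by
  rw [isSeparator_def]
  intro X Y f g h
  ext x
  let k : (preadditiveCoyonedaObj P).obj P ⟶ X := ModuleCat.ofHom
    { toFun := fun b : P ⟶ P => MulOpposite.op (End.of b) • x
      map_add' := fun b c => add_smul (MulOpposite.op (End.of b)) (MulOpposite.op (End.of c)) x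
      map_smul' := fun a b => mul_smul a (MulOpposite.op (End.of b)) x }
  have hk : k (𝟙 P) = x := one_smul _ x
  have := congrArg (fun t => t.hom (𝟙 P)) (h k)
  change f.hom (k.hom (𝟙 P)) = g.hom (k.hom (𝟙 P)) at this
  rwa [hk] at this

instance projective_preadditiveCoyonedaObj_self (P : C) :
    Projective ((preadditiveCoyonedaObj P).obj P) := by
  let e : (End P)ᵐᵒᵖ ≃ₗ[(End P)ᵐᵒᵖ] (preadditiveCoyonedaObj P).obj P :=
    { toFun := fun b => End.asHom b.unop
      invFun := fun b => MulOpposite.op (End.of b)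
      map_add' := fun _ _ => rfl
      map_smul' := fun _ _ => rfl
      left_inv := fun _ => rfl
      right_inv := fun _ => rfl }
  have : Module.Projective (End P)ᵐᵒᵖ ((preadditiveCoyonedaObj P).obj P) :=
    Module.Projective.of_equiv e
  exact (IsProjective.iff_projective _).1 this

end Coyoneda

/-! ### Transfer of `Ext` bijections around a square of functors -/

section Transfer

open Limits Abelian

universe v₁ u₁ u₂ w₁ w₂

variable {C : Type u₁} [Category.{v₁} C] [Abelian C] [HasExt.{w₁} C] [EnoughProjectives C]
  {D : Type u₂} [Category.{v₁} D] [Abelian D] [HasExt.{w₂} D]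

omit [EnoughProjectives C] in
lemma subsingleton_ext_of_iso {X X' Y Y' : C} (e : X ≅ X') (e' : Y ≅ Y') (k : ℕ)
    (h : Subsingleton (Ext X Y k)) : Subsingleton (Ext X' Y' k) := by
  have : Subsingleton (Ext X Y' k) := subsingleton_of_forall_eq 0 fun x => by
    rw [← Ext.comp_mk₀_id x, ← e'.inv_hom_id, ← Ext.mk₀_comp_mk₀,
      ← Ext.comp_assoc _ _ _ (add_zero k) (zero_add 0) (by lia),
      Subsingleton.elim (x.comp (Ext.mk₀ e'.inv) (add_zero k)) 0, Ext.zero_comp]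
  exact subsingleton_ext_of_retract e.inv e.hom e.inv_hom_id k this

omit [EnoughProjectives C] in
lemma comp_mk₀_iso_injective {X Y Y' : C} (e : Y ≅ Y') (k : ℕ) :
    Function.Injective fun x : Ext X Y k => x.comp (Ext.mk₀ e.hom) (add_zero k) := by
  intro x y (h : x.comp _ _ = y.comp _ _)
  rw [← Ext.comp_mk₀_id x, ← Ext.comp_mk₀_id y, ← e.hom_inv_id, ← Ext.mk₀_comp_mk₀,
    ← Ext.comp_assoc _ _ _ (add_zero k) (zero_add 0) (by lia), h,
    Ext.comp_assoc _ _ _ (add_zero k) (zero_add 0) (by lia)]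

omit [EnoughProjectives C] in
lemma mk₀_iso_comp_injective {X X' Y : C} (e : X ≅ X') (k : ℕ) :
    Function.Injective fun x : Ext X' Y k => (Ext.mk₀ e.hom).comp x (zero_add k) := by
  intro x y (h : (Ext.mk₀ e.hom).comp x _ = (Ext.mk₀ e.hom).comp y _)
  rw [← Ext.mk₀_id_comp x, ← Ext.mk₀_id_comp y, ← e.inv_hom_id, ← Ext.mk₀_comp_mk₀,
    Ext.comp_assoc _ _ _ (zero_add 0) (zero_add k) (by lia), h,
    ← Ext.comp_assoc _ _ _ (zero_add 0) (zero_add k) (by lia)]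

omit [EnoughProjectives C] in
lemma comp_mk₀_inv_hom {X Y Y' : C} (e : Y ≅ Y') (k : ℕ) (x : Ext X Y' k) :
    (x.comp (Ext.mk₀ e.inv) (add_zero k)).comp (Ext.mk₀ e.hom) (add_zero k) = x := by
  rw [Ext.comp_assoc _ _ _ (add_zero k) (zero_add 0) (by lia), Ext.mk₀_comp_mk₀, e.inv_hom_id,
    Ext.comp_mk₀_id]

/-- In a square of exact functors commuting up to isomorphism, bijectivity on `Ext` of three sides
implies bijectivity of the fourth. -/
lemma mapExtAddHom_bijective_of_square {D' E : Type*} [Category* D'] [Abelian D'] [HasExt.{u} D']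
    [Category* E] [Abelian E] [HasExt.{v} E]
    (F : C ⥤ D) [F.Additive] [PreservesFiniteLimits F] [PreservesFiniteColimits F]
    (G : D ⥤ E) [G.Additive] [PreservesFiniteLimits G] [PreservesFiniteColimits G]
    (F' : C ⥤ D') [F'.Additive] [PreservesFiniteLimits F'] [PreservesFiniteColimits F']
    (G' : D' ⥤ E) [G'.Additive] [PreservesFiniteLimits G'] [PreservesFiniteColimits G']
    (θ : F ⋙ G ≅ F' ⋙ G') (X Y : C) (n : ℕ) (hF : Function.Bijective (F.mapExtAddHom X Y n))
    (hG : Function.Bijective (G.mapExtAddHom (F.obj X) (F.obj Y) n))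
    (hG' : Function.Bijective (G'.mapExtAddHom (F'.obj X) (F'.obj Y) n)) :
    Function.Bijective (F'.mapExtAddHom X Y n) := by
  have key (e : Ext X Y n) := mapExactFunctor_natIso F G F' G' θ e
  constructor
  · intro e e' (h : e.mapExactFunctor F' = e'.mapExactFunctor F')
    apply hF.1
    apply hG.1
    apply comp_mk₀_iso_injective (θ.app Y)
    exact (key e).trans ((by rw [h] : _ = _).trans (key e').symm)
  · intro y
    obtain ⟨z, hz⟩ := hG.2 (((Ext.mk₀ (θ.hom.app X)).comp (y.mapExactFunctor G') (zero_add n)).comp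
      (Ext.mk₀ (θ.inv.app Y)) (add_zero n))
    obtain ⟨e, rfl⟩ := hF.2 z
    refine ⟨e, hG'.1 (mk₀_iso_comp_injective (θ.app X) n ((key e).symm.trans ?_))⟩
    refine (congrArg (fun t => Ext.comp t (Ext.mk₀ (θ.hom.app Y)) (add_zero n)) hz).trans ?_
    exact comp_mk₀_inv_hom (θ.app Y) n _

/-- Transfer of a cover along a fully faithful exact functor `I : C ⥤ D` with good `Ext`-vanishing
and a universal epimorphism `q : P ⟶ I P'`. -/
theorem mapExtAddHom_preadditiveCoyonedaObj_bijective {C : Type u₁} [Category.{u} C] [Abelian C]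
    [HasExt.{w₁} C] [EnoughProjectives C]
    {D : Type u₂} [Category.{u} D] [Abelian D] [HasExt.{w₂} D]
    (I : C ⥤ D) [I.Additive] [PreservesFiniteLimits I] [PreservesFiniteColimits I] [I.Full]
    [I.Faithful] {P : D} {P' : C} [Projective P] [Projective P'] {K : D} (ι : K ⟶ P)
    (q : P ⟶ I.obj P') (w : ι ≫ q = 0) (hS : (ShortComplex.mk ι q w).ShortExact)
    (hq : ∀ N : C, Function.Bijective fun g : P' ⟶ N => q ≫ I.map g) (X Y : C) (i : ℕ)
    (hI : ∀ Q : C, Projective Q → ∀ k, Subsingleton (Ext (I.obj Q) (I.obj Y) (k + 1)))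
    (hX : ∀ j ≤ i,
      Function.Bijective ((preadditiveCoyonedaObj P).mapExtAddHom (I.obj X) (I.obj Y) j))
    (hK : ∀ j ≤ i, Function.Surjective
      ((preadditiveCoyonedaObj P).mapExtAddHom K (I.obj Y) j))
    (hK' : ∀ j, Subsingleton (Ext K (I.obj Y) j)) (j : ℕ) (hj : j ≤ i) :
    Function.Bijective ((preadditiveCoyonedaObj P').mapExtAddHom X Y j) := by
  have : Epi q := hS.epi_g
  let φ := RingHom.op (endHom I q hq)
  have hφ : Function.Surjective φ := fun b => by
    obtain ⟨f, hf⟩ := endHom_surjective I q hq b.unop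
    exact ⟨MulOpposite.op f, congrArg MulOpposite.op hf⟩
  have := full_restrictScalars φ hφ
  let θ := compCoyonedaIso I q hq
  refine mapExtAddHom_bijective_of_square I (preadditiveCoyonedaObj P) (preadditiveCoyonedaObj P')
    (ModuleCat.restrictScalars φ) θ X Y j
    (mapExtAddHom_bijective_of_vanishing I Y i (fun Q hQ k _ => hI Q hQ k) X j hj) (hX j hj)
    (mapExtAddHom_bijective_of_vanishing _ _ i (fun Q hQ k hk => ?_) _ j hj)
  -- It suffices to test vanishing on the regular module of `(End P')ᵐᵒᵖ`, whose restriction along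
  -- `φ` is `Hom(P, I P')` through `θ`.
  refine subsingleton_ext_of_isSeparator _ (isSeparator_preadditiveCoyonedaObj_self P') k _ ?_ Q
  refine subsingleton_ext_of_iso (θ.app P') (θ.app Y) _ ?_
  refine subsingleton_ext_of_shortExact (hS.map_of_exact (preadditiveCoyonedaObj P)) _ k ?_ ?_
  swap
  · have := projective_preadditiveCoyonedaObj_self P
    exact Ext.subsingleton_of_projective ((preadditiveCoyonedaObj P).obj P) _ k
  -- The shift lowers the degree to `k < i`, where the group in question is the image of the zero
  -- group `Ext^k(K, I Y)`.
  have := hK' k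
  exact (hK k hk.le).subsingleton

end Transfer

/-! ### Direct summands, expressed as finite decompositions of the identity -/

section FiniteSums

open Limits Abelian

variable {A : Type u} [Ring A]

/-- A finitely generated projective module has a finite dual basis. -/
lemma exists_dual_basis (P : Type u) [AddCommGroup P] [Module A P] [Module.Finite A P]
    [Module.Projective A P] :
    ∃ (n : ℕ) (x : Fin n → P) (f : Fin n → P →ₗ[A] A), ∀ p, ∑ t, f t p • x t = p := by
  obtain ⟨n, f, g, -, -, h⟩ := Module.Finite.exists_comp_eq_id_of_projective A P
  refine ⟨n, fun t => f (Pi.single t 1), fun t => LinearMap.proj t ∘ₗ g, fun p => ?_⟩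
  simp only [LinearMap.comp_apply, LinearMap.proj_apply, ← map_smul, ← map_sum]
  have : ∑ t, g p t • (Pi.single t 1 : Fin n → A) = g p := by
    ext s
    simp [Finset.sum_apply, Pi.single_apply]
  rw [this]
  exact LinearMap.congr_fun h p

lemma sum_ofHom_comp_ofHom {X : Type u} [AddCommGroup X] [Module A X] {T : Type*} [Fintype T]
    (Z : T → ModuleCat.{u} A) (s : ∀ t, X →ₗ[A] Z t) (p : ∀ t, Z t →ₗ[A] X)
    (h : ∀ x, ∑ t, p t (s t x) = x) :
    ∑ t, ModuleCat.ofHom (s t) ≫ ModuleCat.ofHom (p t) = 𝟙 (ModuleCat.of A X) := by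
  ext x
  simpa [ModuleCat.hom_sum] using h x

lemma subsingleton_ext_of_sum {C : Type*} [Category* C] [Abelian C] [HasExt.{v} C] {X Y : C}
    {T : Type*} [Fintype T] (Z : T → C) (s : ∀ t, X ⟶ Z t) (p : ∀ t, Z t ⟶ X)
    (hsp : ∑ t, s t ≫ p t = 𝟙 X) (k : ℕ) (h : ∀ t, Subsingleton (Ext (Z t) Y k)) :
    Subsingleton (Ext X Y k) := by
  refine subsingleton_of_forall_eq 0 fun e => ?_
  rw [← Ext.mk₀_id_comp e, ← hsp, Ext.mk₀_sum, Ext.sum_comp]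
  refine Finset.sum_eq_zero fun t _ => ?_
  rw [← Ext.mk₀_comp_mk₀, Ext.comp_assoc _ _ _ (zero_add 0) (zero_add k) (by lia),
    (h t).elim ((Ext.mk₀ (p t)).comp e (zero_add k)) 0, Ext.comp_zero]

/-- If `P` is finitely generated projective, then the identity of `JP` is a finite sum of
endomorphisms factoring through `J`. -/
lemma exists_sum_ideal_smul_top (P : Type u) [AddCommGroup P] [Module A P] [Module.Finite A P]
    [Module.Projective A P] (J : Ideal A) [J.IsTwoSided] :
    ∃ (n : ℕ) (s : Fin n → ↥(J • (⊤ : Submodule A P)) →ₗ[A] J)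
      (p : Fin n → J →ₗ[A] ↥(J • (⊤ : Submodule A P))), ∀ x, ∑ t, p t (s t x) = x := by
  obtain ⟨n, x, f, h⟩ := exists_dual_basis (A := A) P
  -- The dual basis of `P` restricts: `f t` sends `JP` into `J` because `J` is also a right ideal,
  -- and `a ↦ a • x t` sends `J` into `JP`.
  have hf (t : Fin n) (y : P) (hy : y ∈ J • (⊤ : Submodule A P)) : f t y ∈ J := by
    refine Submodule.smul_induction_on hy (fun r hr n _ => ?_) fun y z hy hz => ?_
    · rw [map_smul]
      exact Ideal.IsTwoSided.mul_mem_of_left _ hr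
    · rw [map_add]
      exact add_mem hy hz
  refine ⟨n, fun t => (f t).restrict (hf t), fun t => (LinearMap.toSpanSingleton A P (x t)).restrict
    fun a ha => Submodule.smul_mem_smul ha trivial, fun y => Subtype.ext ?_⟩
  rw [AddSubmonoidClass.coe_finsetSum]
  exact h y

/-- If a direct sum of modules is a generator, then the identity of `A` is a finite sum of
endomorphisms factoring through the summands. -/
lemma exists_sum_of_isGenerator {Λ : Type v} (P : Λ → ModuleCat.{u} A)
    (h : IsGenerator A (⨁ l, P l)) :
    ∃ (T : Type v) (_ : Fintype T) (c : T → Λ) (s : ∀ t, A →ₗ[A] P (c t))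
      (p : ∀ t, P (c t) →ₗ[A] A), ∀ x, ∑ t, p t (s t x) = x := by
  classical
  obtain ⟨n, s, p, h⟩ := h
  -- Maps out of `A` are determined by their value at `1`, so only the finitely many summands met by
  -- the coordinates of `s 1` are needed, even if `Λ` is infinite.
  let T := Σ t : Fin n, {l : Λ // l ∈ (s 1 t).support}
  let s' (t : T) : A →ₗ[A] P t.2.1 := DirectSum.component A Λ _ t.2.1 ∘ₗ LinearMap.proj t.1 ∘ₗ s
  let p' (t : T) : P t.2.1 →ₗ[A] A :=
    p ∘ₗ LinearMap.single A (fun _ : Fin n => ⨁ l, P l) t.1 ∘ₗ DirectSum.lof A Λ (fun l => P l) t.2.1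
  have h1 : ∑ t, p' t ∘ₗ s' t = LinearMap.id := by
    refine LinearMap.ext_ring ?_
    rw [LinearMap.sum_apply, Fintype.sum_sigma]
    have (t : Fin n) : ∑ l : {l : Λ // l ∈ (s 1 t).support}, (p' ⟨t, l⟩ ∘ₗ s' ⟨t, l⟩) 1 =
        p (Pi.single t (s 1 t)) := by
      have h2 := DirectSum.sum_support_of (s 1 t)
      rw [← Finset.sum_coe_sort] at h2
      conv_rhs => rw [← h2, ← LinearMap.single_apply (R := A), map_sum, map_sum]
      rfl
    simp only [this]
    rw [← map_sum, Finset.univ_sum_single]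
    exact LinearMap.congr_fun h 1
  refine ⟨ULift.{v} T, inferInstance, fun t => t.down.2.1, fun t => s' t.down, fun t => p' t.down,
    fun x => ?_⟩
  rw [Fintype.sum_equiv Equiv.ulift (fun t : ULift.{v} T => p' t.down (s' t.down x))
    (fun t => p' t (s' t x)) fun _ => rfl]
  simpa using LinearMap.congr_fun h1 x

end FiniteSums

/-! ### Filtered modules and standard modules -/

section Filtration

variable {A : Type u} [Ring A]

lemma HasFiltration.mono {S S' : ModuleCat.{u} A → Prop} (h : ∀ X, S X → S' X) {X : ModuleCat.{u} A}
    (hX : HasFiltration S X) : HasFiltration S' X := by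
  induction hX with
  | zero X h => exact .zero X h
  | step X' X Q f g hf hfg hg _ hQ ih => exact .step X' X Q f g hf hfg hg ih (h _ hQ)

lemma HasFiltration.subsingleton {S : ModuleCat.{u} A → Prop} (h : ∀ X, ¬ S X) {X : ModuleCat.{u} A}
    (hX : HasFiltration S X) : Subsingleton X := by
  cases hX with
  | zero X h => exact h
  | step X' X Q f g hf hfg hg _ hQ => exact (h _ hQ).elim

variable (R : Type u) [CommRing R] [Algebra R A]
  {Λ : Type v} (Δ : Λ → Type u) [∀ l, AddCommGroup (Δ l)] [∀ l, Module R (Δ l)]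
  [∀ l, Module A (Δ l)] [∀ l, IsScalarTower R A (Δ l)]

lemma IsStandardTensor.mono {p p' : Λ → Prop} (h : ∀ l, p l → p' l) {X : ModuleCat.{u} A}
    (hX : IsStandardTensor R Δ p X) : IsStandardTensor R Δ p' X := by
  obtain ⟨l, hl, hX⟩ := hX
  exact ⟨l, h l hl, hX⟩

lemma isStandardTensor_standard (l : Λ) :
    IsStandardTensor R Δ (fun _ => True) (ModuleCat.of A (Δ l)) :=
  ⟨l, trivial, R, _, _, inferInstance, inferInstance,
    ⟨(TensorProduct.AlgebraTensorModule.rid R A (Δ l)).symm⟩⟩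

/-- An extension of a standard module by a filtered module is filtered. -/
lemma fDelta_of_surjective {p : Λ → Prop} {P : ModuleCat.{u} A} {l : Λ} (π : P →ₗ[A] Δ l)
    (hπ : Function.Surjective π)
    (h : HasFiltration (IsStandardTensor R Δ p) (ModuleCat.of A (LinearMap.ker π))) :
    FDelta R Δ P :=
  .step (ModuleCat.of A (LinearMap.ker π)) P (ModuleCat.of A (Δ l)) (LinearMap.ker π).subtype π
    (Submodule.injective_subtype _) (LinearMap.exact_subtype_ker_map π) hπ
    (h.mono fun _ => .mono R Δ fun _ _ => trivial) (isStandardTensor_standard R Δ l)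

end Filtration

/-! ### The universal map `P → P/JP` and the vanishing of `Ext_A(J, N)` -/

section Quotient

open Limits Abelian

variable {A : Type u} [Ring A] (J : Ideal A) [J.IsTwoSided]

lemma smul_inflation_eq_zero {N : ModuleCat.{u} (A ⧸ J)} {a : A} (ha : a ∈ J)
    (x : (inflation J).obj N) : a • x = 0 := by
  change Ideal.Quotient.mk J a • (show N from x) = 0
  rw [Ideal.Quotient.eq_zero_iff_mem.2 ha, zero_smul]

variable (P : Type u) [AddCommGroup P] [Module A P]

/-- The canonical map from `P` to `P/JP`. -/
noncomputable def toQuotient : ModuleCat.of A P ⟶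
    (inflation J).obj (ModuleCat.of (A ⧸ J) (P ⧸ J • (⊤ : Submodule A P))) :=
  ModuleCat.ofHom
    (Y := (inflation J).obj (ModuleCat.of (A ⧸ J) (P ⧸ J • (⊤ : Submodule A P))))
    { toFun := fun x => Submodule.Quotient.mk x
      map_add' := fun _ _ => rfl
      map_smul' := fun _ _ => rfl }

lemma toQuotient_surjective : Function.Surjective (toQuotient J P) :=
  Submodule.Quotient.mk_surjective _

/-- A map from `P` to a module killed by `J` vanishes on `JP`, and the induced map on `P/JP` is
automatically `A/J`-linear. -/
lemma toQuotient_universal (N : ModuleCat.{u} (A ⧸ J)) : Function.Bijective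
    fun g : ModuleCat.of (A ⧸ J) (P ⧸ J • (⊤ : Submodule A P)) ⟶ N =>
      toQuotient J P ≫ (inflation J).map g := by
  constructor
  · intro g h hgh
    refine ModuleCat.hom_ext (LinearMap.ext fun y => ?_)
    obtain ⟨x, rfl⟩ := toQuotient_surjective J P y
    exact ConcreteCategory.congr_hom hgh x
  · intro f
    have hf : J • (⊤ : Submodule A P) ≤ LinearMap.ker f.hom := by
      rw [Submodule.smul_le]
      intro a ha x _
      rw [LinearMap.mem_ker, map_smul]
      exact smul_inflation_eq_zero J ha _
    let g := Submodule.liftQ _ f.hom hf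
    refine ⟨ModuleCat.ofHom (Y := N)
      { toFun := fun x => g x
        map_add' := fun x y => map_add g x y
        map_smul' := fun b x => ?_ }, rfl⟩
    obtain ⟨a, rfl⟩ := Ideal.Quotient.mk_surjective b
    exact map_smul g a x

lemma shortExact_toQuotient :
    ∃ w, (ShortComplex.mk (ModuleCat.ofHom (J • (⊤ : Submodule A P)).subtype)
      (toQuotient J P) w).ShortExact := by
  refine ⟨?_, ?_⟩
  · ext x
    exact (Submodule.Quotient.mk_eq_zero _).2 x.2
  · refine @ShortComplex.ShortExact.mk _ _ _ _ ?_ ?_ ?_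
    · rw [ShortComplex.ShortExact.moduleCat_exact_iff_function_exact]
      intro x
      exact (Submodule.Quotient.mk_eq_zero _).trans (by simp)
    · exact (ModuleCat.mono_iff_injective _).2 (Submodule.injective_subtype _)
    · exact (ModuleCat.epi_iff_surjective _).2 (toQuotient_surjective J P)

/-- Lifting problems for `P'` correspond under `q` to lifting problems for `P`; with inflation as
`I` this makes `P/JP` projective over `A/J`. -/
lemma projective_of_universal {C D : Type*} [Category* C] [Category* D] (I : C ⥤ D)
    [I.PreservesEpimorphisms] {P : D} {P' : C} [Projective P] (q : P ⟶ I.obj P')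
    (hq : ∀ N : C, Function.Bijective fun g : P' ⟶ N => q ≫ I.map g) : Projective P' where
  factors {X Y} f e _ := by
    obtain ⟨g, hg⟩ := (hq X).2 (Projective.factorThru (q ≫ I.map f) (I.map e))
    refine ⟨g, (hq Y).1 ?_⟩
    have hg : q ≫ I.map g = _ := hg
    change q ≫ I.map (g ≫ e) = q ≫ I.map f
    rw [I.map_comp, reassoc_of% hg, Projective.factorThru_comp]

lemma isSeparator_of_self (B : Type u) [Ring B] : IsSeparator (ModuleCat.of B B) := by
  rw [isSeparator_def]
  intro X Y f g h
  ext x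
  have := congrArg (fun t => t.hom 1) (h (ModuleCat.ofHom (LinearMap.toSpanSingleton B X x)))
  simpa using this

/-- `Ext^k(J, N)` vanishes for all `k` if `J` is idempotent and projective and `JN = 0`. -/
lemma subsingleton_ext_ideal [Module.Projective A J] (hJ : J * J = J) (N : ModuleCat.{u} (A ⧸ J))
    (k : ℕ) : Subsingleton (Ext (ModuleCat.of A J) ((inflation J).obj N) k) := by
  cases k with
  | zero =>
    refine subsingleton_of_forall_eq 0 fun e => ?_
    obtain ⟨f, rfl⟩ := (Ext.mk₀_bijective _ _).2 e
    rw [Ext.mk₀_eq_zero_iff]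
    -- For `r, n ∈ J`, `f (r n) = r f(n) = 0`; as `J = J * J`, this gives `f = 0`.
    have h : J * J ≤ (LinearMap.ker f.hom).map J.subtype := by
      refine Submodule.smul_le.2 fun r hr n hn => ⟨r • ⟨n, hn⟩, ?_, rfl⟩
      exact (map_smul f.hom r ⟨n, hn⟩).trans (smul_inflation_eq_zero J hr _)
    rw [hJ] at h
    ext x
    obtain ⟨y, hy, hyx⟩ := h x.2
    obtain rfl : y = x := Subtype.ext hyx
    exact hy
  | succ k =>
    have : Projective (ModuleCat.of A J) := (IsProjective.iff_projective _).1 inferInstance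
    exact Ext.subsingleton_of_projective _ _ k

end Quotient

/-! ### Covers of the quotient algebra -/

section Cover

open Limits Abelian

variable {A : Type u} [Ring A] (J : Ideal A) [J.IsTwoSided]

/-- `Ext_A^k(Q, N)` vanishes for `k` positive, `N` an `A/J`-module and `Q` a projective
`A/J`-module, if `J` is idempotent and projective. -/
lemma subsingleton_ext_inflation [Module.Projective A J] (hJ : J * J = J)
    (N Q : ModuleCat.{u} (A ⧸ J)) [Projective Q] (k : ℕ) :
    Subsingleton (Ext ((inflation J).obj Q) ((inflation J).obj N) (k + 1)) := by
  refine subsingleton_ext_of_isSeparator (inflation J) (isSeparator_of_self (A ⧸ J)) k _ ?_ Q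
  let S : ShortComplex (ModuleCat.{u} A) := ShortComplex.mk (ModuleCat.ofHom J.subtype)
    (ModuleCat.ofHom (Y := (inflation J).obj (ModuleCat.of (A ⧸ J) (A ⧸ J)))
      { toFun := fun x => Ideal.Quotient.mk J x
        map_add' := fun _ _ => rfl
        map_smul' := fun _ _ => rfl }) (by
      ext x
      exact Ideal.Quotient.eq_zero_iff_mem.2 x.2)
  have hS : S.ShortExact := by
    refine @ShortComplex.ShortExact.mk _ _ _ _ ?_ ?_ ?_
    · rw [ShortComplex.ShortExact.moduleCat_exact_iff_function_exact]
      intro x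
      exact Ideal.Quotient.eq_zero_iff_mem.trans ⟨fun h => ⟨⟨x, h⟩, rfl⟩, fun ⟨y, hy⟩ => hy ▸ y.2⟩
    · exact (ModuleCat.mono_iff_injective _).2 (Submodule.injective_subtype _)
    · exact (ModuleCat.epi_iff_surjective _).2 Ideal.Quotient.mk_surjective
  have : Projective (ModuleCat.of A A) := (IsProjective.iff_projective _).1 inferInstance
  exact subsingleton_ext_of_shortExact hS _ k (subsingleton_ext_ideal J hJ N k)
    (Ext.subsingleton_of_projective (ModuleCat.of A A) _ k)

/-- Covers pass to the quotient by an idempotent ideal that is finitely generated projective as a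
left module, if the class generates `A`. -/
theorem IsCover.quotient [Module.Finite A J] [Module.Projective A J] (hJ : J * J = J) {i : ℕ}
    {𝒜 : ModuleCat.{u} A → Prop} {P : Type u} [AddCommGroup P] [Module A P] (hP : IsCover i 𝒜 P)
    {T : Type v} [Fintype T] (Z : T → ModuleCat.{u} A) (hZ : ∀ t, 𝒜 (Z t))
    (s : ∀ t, A →ₗ[A] Z t) (p : ∀ t, Z t →ₗ[A] A) (hsp : ∀ x, ∑ t, p t (s t x) = x) :
    IsCover i (fun X => 𝒜 ((inflation J).obj X)) (P ⧸ J • (⊤ : Submodule A P)) := by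
  obtain ⟨hfin, hproj, hP⟩ := hP
  have hproj' : Module.Projective A P := (IsProjective.iff_projective _).2 hproj
  have hq := toQuotient_universal J P
  have hfin' : Module.Finite (A ⧸ J) (P ⧸ J • (⊤ : Submodule A P)) :=
    Module.Finite.of_restrictScalars_finite A _ _
  have hproj'' := projective_of_universal (inflation J) (toQuotient J P) hq
  have := full_restrictScalars (Ideal.Quotient.mk J) Ideal.Quotient.mk_surjective
  refine ⟨hfin', hproj'', fun X Y hX hY j hj => ?_⟩
  obtain ⟨n, s₁, p₁, h₁⟩ := exists_sum_ideal_smul_top P J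
  obtain ⟨m, x, f, hxf⟩ := exists_dual_basis (A := A) J
  obtain ⟨w, hS⟩ := shortExact_toQuotient J P
  have h₁' := sum_ofHom_comp_ofHom (fun _ => ModuleCat.of A J) s₁ p₁ h₁
  -- The cover property at the `Z t` spreads to `A`, then to `J`, then to `JP`, each being a summand
  -- of a finite sum of copies of the preceding ones.
  have hbij (k : ℕ) (hk : k ≤ i) := mapExtAddHom_bijective_of_sum (schurFunctor A P)
    (fun _ => ModuleCat.of A J) _ _ h₁' k fun _ =>
      mapExtAddHom_bijective_of_sum (schurFunctor A P) (fun _ => ModuleCat.of A A) _ _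
        (sum_ofHom_comp_ofHom (fun _ => ModuleCat.of A A) f
          (fun t => LinearMap.toSpanSingleton A J (x t)) hxf) k fun _ =>
        mapExtAddHom_bijective_of_sum (schurFunctor A P) Z _ _ (sum_ofHom_comp_ofHom Z s p hsp) k
          fun t => hP (Z t) ((inflation J).obj Y) (hZ t) hY k hk
  exact mapExtAddHom_preadditiveCoyonedaObj_bijective (inflation J) _ (toQuotient J P) w hS hq X Y i
    (fun Q _ k => subsingleton_ext_inflation J hJ Y Q k)
    (fun k hk => hP _ _ hX hY k hk) (fun k hk => (hbij k hk).2)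
    (fun k => subsingleton_ext_of_sum _ _ _ h₁' k fun _ => subsingleton_ext_ideal J hJ Y k) j hj

end Cover

/-! ### The trace ideal of a maximal standard module -/

section Trace

variable {A : Type u} [Ring A]

/-- A finitely generated projective module equals its product with its trace ideal. -/
lemma trace_smul_top (M : Type u) [AddCommGroup M] [Module A M] [Module.Finite A M]
    [Module.Projective A M] :
    (⨆ f : M →ₗ[A] A, LinearMap.range f) • (⊤ : Submodule A M) = ⊤ := by
  obtain ⟨n, x, f, h⟩ := exists_dual_basis (A := A) M
  refine eq_top_iff.2 fun y _ => ?_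
  rw [← h y]
  exact sum_mem fun t _ => Submodule.smul_mem_smul
    (le_iSup (fun f : M →ₗ[A] A => LinearMap.range f) (f t) ⟨y, rfl⟩) trivial

variable {R : Type u} [CommRing R] [Algebra R A]
  {Λ : Type v} {Δ : Λ → Type u} [∀ l, AddCommGroup (Δ l)] [∀ l, Module R (Δ l)]
  [∀ l, Module A (Δ l)] [∀ l, IsScalarTower R A (Δ l)]

/-- No index lies above a maximal `l`, so the kernel of `P(l) → Δ(l)` has no possible factor and is
zero. Hence `Δ(l)` is projective. -/
lemma IsSplitQuasiHereditary.trace_smul_top [PartialOrder Λ] (hA : IsSplitQuasiHereditary R A Δ)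
    {l : Λ} (hl : IsMax l) :
    (⨆ f : Δ l →ₗ[A] A, LinearMap.range f) • (⊤ : Submodule A (Δ l)) = ⊤ := by
  obtain ⟨P, hP, -⟩ := hA.exists_progenerator
  obtain ⟨hfin, hproj, π, hπ, hker⟩ := hP l
  have : Subsingleton (LinearMap.ker π) :=
    hker.subsingleton fun X ⟨m, hm, _⟩ => hl.not_lt hm
  have hinj : Function.Injective π :=
    LinearMap.ker_eq_bot.1 (Submodule.subsingleton_iff_eq_bot.1 this)
  have : Module.Projective A (Δ l) := .of_equiv (LinearEquiv.ofBijective π ⟨hinj, hπ⟩)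
  have := hA.finite_standard l
  exact SplitQH.trace_smul_top (A := A) (Δ l)

/-- If `JM = M` and `X ≅ M ⊗ U` is annihilated by `J`, then `X = 0`. -/
lemma subsingleton_of_equiv_tensor {M : Type u} [AddCommGroup M] [Module R M] [Module A M]
    [IsScalarTower R A M] (J : Ideal A) (hM : J • (⊤ : Submodule A M) = ⊤) {U : Type u}
    [AddCommGroup U] [Module R U] {X : Type u} [AddCommGroup X] [Module A X]
    (e : X ≃ₗ[A] M ⊗[R] U) (hX : ∀ a ∈ J, ∀ x : X, a • x = 0) : Subsingleton X := by
  have h0 (a : A) (ha : a ∈ J) (y : M ⊗[R] U) : a • y = 0 := by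
    rw [← e.apply_symm_apply y, ← map_smul, hX a ha, map_zero]
  have h (y : M ⊗[R] U) : y = 0 := by
    induction y using TensorProduct.induction_on with
    | zero => rfl
    | tmul m t =>
      have hm : m ∈ J • (⊤ : Submodule A M) := hM.symm ▸ Submodule.mem_top
      refine Submodule.smul_induction_on hm (fun a ha x _ => ?_) fun x y hx hy => ?_
      · rw [← TensorProduct.smul_tmul']
        exact h0 a ha _
      · rw [TensorProduct.add_tmul, hx, hy, add_zero]
    | add x y hx hy => rw [hx, hy, add_zero]
  exact subsingleton_of_forall_eq 0 fun x => e.injective ((h _).trans (h _).symm)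

end Trace

/-! ### Comparing filtrations over `A` and over `A/J` -/

section FiltrationQuotient

variable {A : Type u} [Ring A] (J : Ideal A) [J.IsTwoSided]

lemma HasFiltration.inflation {S : ModuleCat.{u} A → Prop} {X : ModuleCat.{u} (A ⧸ J)}
    (hX : HasFiltration (fun Y => S ((inflation J).obj Y)) X) :
    HasFiltration S ((SplitQH.inflation J).obj X) := by
  induction hX with
  | zero X h => exact .zero _ h
  | step X' X Q f g hf hfg hg _ hQ ih =>
    exact .step _ _ _ ((SplitQH.inflation J).map (ModuleCat.ofHom f)).hom
      ((SplitQH.inflation J).map (ModuleCat.ofHom g)).hom hf hfg hg ih hQ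

/-- A filtration of an `A/J`-module by `A`-modules is a filtration by `A/J`-modules, from which the
factors in a class that contains no nonzero `A/J`-module may be dropped. -/
lemma HasFiltration.of_inflation {S S' : ModuleCat.{u} A → Prop}
    (hiso : ∀ Q Q' : ModuleCat.{u} A, S' Q → Nonempty (Q ≃ₗ[A] Q') → S' Q')
    (hS : ∀ Q, S Q → (∀ a ∈ J, ∀ x : Q, a • x = 0) → S' Q ∨ Subsingleton Q) {X : ModuleCat.{u} A}
    (hX : HasFiltration S X) (Y : ModuleCat.{u} (A ⧸ J)) (e : X ≃ₗ[A] (SplitQH.inflation J).obj Y) :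
    HasFiltration (fun Z => S' ((SplitQH.inflation J).obj Z)) Y := by
  induction hX generalizing Y with
  | zero X h => exact .zero _ e.symm.toEquiv.subsingleton
  | step X' X Q f g hf hfg hg _ hQ ih =>
    have hQ0 (a : A) (ha : a ∈ J) (x : Q) : a • x = 0 := by
      obtain ⟨x, rfl⟩ := hg x
      rw [← map_smul, ← e.symm_apply_apply (a • x), map_smul, smul_inflation_eq_zero J ha, map_zero,
        map_zero]
    obtain h | h := hS Q hQ hQ0
    -- The image of `X'` in `Y` is an `A/J`-submodule, to which the induction applies; the top
    -- factor `Q` becomes `Y ⧸ Y'`.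
    · let Y' : Submodule (A ⧸ J) Y :=
        { carrier := Set.range fun x => e (f x)
          add_mem' := by
            rintro _ _ ⟨x, rfl⟩ ⟨y, rfl⟩
            exact ⟨x + y, by simp only [map_add]; rfl⟩
          zero_mem' := ⟨0, by simp only [map_zero]; rfl⟩
          smul_mem' := by
            rintro b _ ⟨x, rfl⟩
            obtain ⟨a, rfl⟩ := Ideal.Quotient.mk_surjective b
            refine ⟨a • x, ?_⟩
            simp only [map_smul]
            rfl }
      let e' : X' →ₗ[A] (SplitQH.inflation J).obj (ModuleCat.of (A ⧸ J) Y') :=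
        { toFun := fun x => (⟨e (f x), x, rfl⟩ : Y')
          map_add' := fun x y => Subtype.ext (by simp only [map_add]; rfl)
          map_smul' := fun a x => Subtype.ext (by simp only [map_smul]; rfl) }
      have he' : Function.Bijective e' :=
        ⟨fun x y hxy => hf (e.injective (congrArg Subtype.val hxy)),
          fun ⟨_, x, hx⟩ => ⟨x, Subtype.ext hx⟩⟩
      let r : X →ₗ[A] (SplitQH.inflation J).obj (ModuleCat.of (A ⧸ J) (Y ⧸ Y')) :=
        { toFun := fun x => (Submodule.Quotient.mk (p := Y') (e x) : Y ⧸ Y')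
          map_add' := fun x y => by rw [map_add]; rfl
          map_smul' := fun a x => by rw [map_smul]; rfl }
      have hr : Function.Surjective r := fun y => by
        obtain ⟨y, rfl⟩ := Submodule.Quotient.mk_surjective Y' y
        exact ⟨e.symm y, congrArg (Submodule.Quotient.mk (p := Y')) (e.apply_symm_apply y)⟩
      have hker : LinearMap.ker g = LinearMap.ker r := by
        ext x
        rw [LinearMap.mem_ker, LinearMap.mem_ker, hfg x]
        refine Iff.trans ?_ (Submodule.Quotient.mk_eq_zero Y' (x := e x)).symm
        exact ⟨fun ⟨z, hz⟩ => ⟨z, congrArg e hz⟩, fun ⟨z, hz⟩ => ⟨z, e.injective hz⟩⟩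
      let eQ : Q ≃ₗ[A] (SplitQH.inflation J).obj (ModuleCat.of (A ⧸ J) (Y ⧸ Y')) :=
        (g.quotKerEquivOfSurjective hg).symm.trans
          ((Submodule.quotEquivOfEq _ _ hker).trans (r.quotKerEquivOfSurjective hr))
      exact .step (ModuleCat.of (A ⧸ J) Y') Y (ModuleCat.of (A ⧸ J) (Y ⧸ Y')) Y'.subtype Y'.mkQ
        (Submodule.injective_subtype _) (LinearMap.exact_subtype_mkQ Y')
        (Submodule.mkQ_surjective _) (ih _ (LinearEquiv.ofBijective e' he')) (hiso _ _ h ⟨eQ⟩)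
    -- Here `Q = 0`, so `f` is an isomorphism and this step of the filtration is skipped.
    · exact ih Y ((LinearEquiv.ofBijective f
        ⟨hf, fun x => (hfg x).1 (Subsingleton.elim _ _)⟩).trans e)

end FiltrationQuotient

end SplitQH

theorem mainTheorem10 {R : Type u} [CommRing R] [IsNoetherianRing R]
    {A : Type u} [Ring A] [Algebra R A]
    {Λ : Type v} [PartialOrder Λ] (Δ : Λ → Type u) [∀ l, AddCommGroup (Δ l)]
    [∀ l, Module R (Δ l)] [∀ l, Module A (Δ l)] [∀ l, IsScalarTower R A (Δ l)]
    (hA : SplitQH.IsSplitQuasiHereditary R A Δ)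
    (P : Type u) [AddCommGroup P] [Module A P] (i : ℕ)
    (hP : SplitQH.IsCover i (SplitQH.FDelta (A := A) R Δ) P)
    (J : Ideal A) [J.IsTwoSided] (hJ : SplitQH.IsSplitHeredityIdeal R J) :
    SplitQH.IsCover i (SplitQH.FDeltaQuotient R Δ J) (P ⧸ J • (⊤ : Submodule A P)) ∧
    -- if `J` is the ideal attached to a maximal `l₀`, the class of modules above consists of the
    -- `A/J`-modules filtered by the remaining standard modules
    ∀ l₀ : Λ, IsMax l₀ → J = (⨆ f : Δ l₀ →ₗ[A] A, LinearMap.range f) →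
      ∀ X : ModuleCat.{u} (A ⧸ J), SplitQH.FDeltaQuotient R Δ J X ↔
        SplitQH.HasFiltration (fun S : ModuleCat.{u} (A ⧸ J) =>
          SplitQH.IsStandardTensor R Δ (fun m => m ≠ l₀) ((SplitQH.inflation J).obj S)) X := by
  refine ⟨?_, fun l₀ hl₀ hJl X => ⟨fun hX => ?_, fun hX => ?_⟩⟩
  · have := hJ.finite_ideal
    have := hJ.projective_ideal
    obtain ⟨Q, hQ, hgen⟩ := hA.exists_progenerator
    obtain ⟨T, _, c, s, p, hsp⟩ := SplitQH.exists_sum_of_isGenerator Q hgen.2.2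
    refine hP.quotient J hJ.mul_self (fun t => Q (c t)) (fun t => ?_) s p hsp
    obtain ⟨-, -, π, hπ, hker⟩ := hQ (c t)
    exact SplitQH.fDelta_of_surjective R Δ π hπ hker
  · refine SplitQH.HasFiltration.of_inflation J ?_ ?_ hX X (LinearEquiv.refl _ _)
    · rintro Q Q' ⟨l, hl, U, _, _, h₁, h₂, ⟨e⟩⟩ ⟨e'⟩
      exact ⟨l, hl, U, _, _, h₁, h₂, ⟨e'.symm.trans e⟩⟩
    · rintro Q ⟨l, -, U, _, _, h₁, h₂, ⟨e⟩⟩ hQ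
      -- A factor `Δ(l₀) ⊗ U` killed by `J` is zero because `J Δ(l₀) = Δ(l₀)`; all other factors are
      -- kept.
      by_cases hl : l = l₀
      · subst hl
        exact .inr (SplitQH.subsingleton_of_equiv_tensor J (hJl ▸ hA.trace_smul_top hl₀) e hQ)
      · exact .inl ⟨l, hl, U, _, _, h₁, h₂, ⟨e⟩⟩
  · exact SplitQH.HasFiltration.mono (fun _ => .mono R Δ fun _ _ => trivial)
      (SplitQH.HasFiltration.inflation J hX)
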